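/- Let $p\in\mathbb N$, let $\Sigma$ be a map from $\mathbb R^p$ to the (real symmetric) positive definite $p\times p$ matrices, and let $F$ be a nonnegative measure on $\mathbb R_+=[0,\infty)$. Put $\Sigma(s_1,s_2)=\tfrac12(\Sigma(s_1)+\Sigma(s_2))$ and $Q(s_1,s_2)=(s_1-s_2)'\,\Sigma(s_1,s_2)^{-1}(s_1-s_2)$. A function $\varphi$ with domain $D(\varphi)$, $(0,\infty)\subseteq D(\varphi)\subseteq\mathbb R$, is said to belong to $\Phi_{\rm cm}$ (completely monotone generators) if it is the Laplace transform of a nonnegative measure $\nu$ on $[0,\infty)$, i.e. $\varphi(t)=\int_0^\infty e^{-rt}\,d\nu(r)$ with convergent integral for all $t\in D(\varphi)$, and is injective on $D(\varphi)$; $\varphi^{-1}$ denotes its inverse, defined on $\varphi(D(\varphi))$. Let $\varphi_1,\varphi_2\in\Phi_{\rm cm}$, with $0\in D(\varphi_1)$. For each $s\in\mathbb R^p$ let $g_s=g(\cdot\,;s):\mathbb R_+\to[0,\infty)$ be $F$-measurable with values in $\varphi_2(D(\varphi_2))$; if $\varphi_2(t)\to0$ as $t\to\infty$ the value $0$ is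 also allowed, with the convention $\varphi_2^{-1}(0)=+\infty$, $\varphi_2(+\infty)=0$. Assume that the quasi-arithmetic composition with unit weights $$\mathcal Q_{\psi_2}(g_{s_1},g_{s_2})(\tau)=\varphi_2\bigl(\varphi_2^{-1}(g(\tau;s_1))+\varphi_2^{-1}(g(\tau;s_2))\bigr)$$ is defined, i.e. that the argument of $\varphi_2$ lies in $D(\varphi_2)$ (or is $+\infty$) for all $s_1,s_2,\tau$. Assume finally that either (i) $\int_0^\infty \varphi_1(0)\,\mathcal Q_{\psi_2}(g_s,g_s)(\tau)\,dF(\tau)<\infty$ for every $s$, or (ii) $F$ is finite, $D(\varphi_2)=[0,\infty)$, and $\varphi_2^{-1}\circ g(\cdot\,;s)\in L^1(F)$ for every $s$. Then for all $s_1,s_2$ the integral in $$C(s_1,s_2)=\frac{|\Sigma(s_1)|^{1/4}|\Sigma(s_2)|^{1/4}}{|\Sigma(s_1,s_2)|^{1/2}}\int_0^\infty\varphi_1\bigl(Q(s_1,s_2)\tau\bigr)\,\mathcal Q_{\psi_2}(g_{s_1},g_{s_2})(\tau)\,dF(\tau)$$ converges absolutely, and $C$ is a (in general nonstationary) covariance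 function on $\mathbb R^p\times\mathbb R^p$: it is symmetric and $\sum_{i,j=1}^n c_ic_jC(x_i,x_j)\ge0$ for all $n$, $x_1,\dots,x_n\in\mathbb R^p$ and $c_1,\dots,c_n\in\mathbb R$. Moreover, this generalises Stein's (2005b) kernel: if $g(\cdot\,;s)\ge0$ and $g(\cdot\,;s)\in L^2(F)$ for every $s$, then $\varphi_1(t)=\varphi_2(t)=e^{-t}$ with $D(\varphi_1)=D(\varphi_2)=\mathbb R$ satisfies all the above assumptions, including (i), and $$C(s_1,s_2)=\frac{|\Sigma(s_1)|^{1/4}|\Sigma(s_2)|^{1/4}}{|\Sigma(s_1,s_2)|^{1/2}}\int_0^\infty e^{-Q(s_1,s_2)\tau}\,g(\tau;s_1)\,g(\tau;s_2)\,dF(\tau).$$ -/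

import Mathlib

open MeasureTheory Filter Topology
open scoped NNReal Matrix

noncomputable section

/-- The class `Φ_cm`: `φ`, with domain `D ⊇ (0, ∞)`, is the Laplace transform
`φ t = ∫ exp (-r t) dν(r)` of a nonnegative measure `ν` on `[0, ∞)`, the integral converging for
every `t ∈ D`, and `φ` is injective on `D`, so that it has a proper inverse.
The measure `ν` is bounded exactly when the integral converges at `t = 0`. -/
structure IsCompletelyMonotoneGenerator (D : Set ℝ) (φ : ℝ → ℝ) : Prop where
  pos_subset : Set.Ioi 0 ⊆ D
  injOn : Set.InjOn φ D
  laplace : ∃ ν : Measure ℝ≥0, ∀ t ∈ D,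
    Integrable (fun r : ℝ≥0 => Real.exp (-((r : ℝ) * t))) ν ∧
      φ t = ∫ r : ℝ≥0, Real.exp (-((r : ℝ) * t)) ∂ν

/-- The inverse `φ⁻¹ : φ(D) → D` (only its values on `φ(D)` matter). -/
def generatorInv (D : Set ℝ) (φ : ℝ → ℝ) : ℝ → ℝ :=
  Function.invFunOn φ D

/-- The quasi-arithmetic functional with both weights equal to one,
`ψ(u, v) = φ (φ⁻¹ u + φ⁻¹ v)`. The value `0` outside `φ(D)` is only used for `u = 0` or `v = 0`,
under the convention `φ⁻¹ 0 = +∞`, `φ (+∞) = 0`. -/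
def quasiArithmetic (D : Set ℝ) (φ : ℝ → ℝ) (u v : ℝ) : ℝ :=
  open Classical in
  if u ∈ φ '' D ∧ v ∈ φ '' D then φ (generatorInv D φ u + generatorInv D φ v) else 0

/-- `Σ(s₁, s₂) = (Σ(s₁) + Σ(s₂)) / 2`. -/
def avgMatrix {p : ℕ} (S : (Fin p → ℝ) → Matrix (Fin p) (Fin p) ℝ) (s₁ s₂ : Fin p → ℝ) :
    Matrix (Fin p) (Fin p) ℝ :=
  (1 / 2 : ℝ) • (S s₁ + S s₂)

/-- `Q(s₁, s₂) = (s₁ - s₂)' Σ(s₁, s₂)⁻¹ (s₁ - s₂)`. -/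
def quadForm {p : ℕ} (S : (Fin p → ℝ) → Matrix (Fin p) (Fin p) ℝ) (s₁ s₂ : Fin p → ℝ) : ℝ :=
  (s₁ - s₂) ⬝ᵥ ((avgMatrix S s₁ s₂)⁻¹ *ᵥ (s₁ - s₂))

/-- `|Σ(s₁)|^{1/4} |Σ(s₂)|^{1/4} / |Σ(s₁, s₂)|^{1/2}`. -/
def detFactor {p : ℕ} (S : (Fin p → ℝ) → Matrix (Fin p) (Fin p) ℝ) (s₁ s₂ : Fin p → ℝ) : ℝ :=
  (S s₁).det ^ (1 / 4 : ℝ) * (S s₂).det ^ (1 / 4 : ℝ) / (avgMatrix S s₁ s₂).det ^ (1 / 2 : ℝ)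

/-- The integrand `τ ↦ φ₁ (Q(s₁, s₂) τ) · Q_{ψ₂}(g_{s₁}, g_{s₂})(τ)`. -/
def quasiIntegrand {p : ℕ} (S : (Fin p → ℝ) → Matrix (Fin p) (Fin p) ℝ)
    (φ₁ : ℝ → ℝ) (D₂ : Set ℝ) (φ₂ : ℝ → ℝ) (g : (Fin p → ℝ) → ℝ≥0 → ℝ)
    (s₁ s₂ : Fin p → ℝ) (τ : ℝ≥0) : ℝ :=
  φ₁ (quadForm S s₁ s₂ * τ) * quasiArithmetic D₂ φ₂ (g s₁ τ) (g s₂ τ)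

/-- The kernel `C_s(s₁, s₂)`. -/
def quasiKernel {p : ℕ} (S : (Fin p → ℝ) → Matrix (Fin p) (Fin p) ℝ) (F : Measure ℝ≥0)
    (φ₁ : ℝ → ℝ) (D₂ : Set ℝ) (φ₂ : ℝ → ℝ) (g : (Fin p → ℝ) → ℝ≥0 → ℝ)
    (s₁ s₂ : Fin p → ℝ) : ℝ :=
  detFactor S s₁ s₂ * ∫ τ : ℝ≥0, quasiIntegrand S φ₁ D₂ φ₂ g s₁ s₂ τ ∂F

/-- Stein's kernel. -/
def steinKernel {p : ℕ} (S : (Fin p → ℝ) → Matrix (Fin p) (Fin p) ℝ) (F : Measure ℝ≥0)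
    (g : (Fin p → ℝ) → ℝ≥0 → ℝ) (s₁ s₂ : Fin p → ℝ) : ℝ :=
  detFactor S s₁ s₂ *
    ∫ τ : ℝ≥0, Real.exp (-(quadForm S s₁ s₂ * τ)) * (g s₁ τ * g s₂ τ) ∂F

/-- A (not necessarily stationary) covariance function: symmetric and positive definite in the
sense that `∑ᵢ ∑ⱼ cᵢ cⱼ C(xᵢ, xⱼ) ≥ 0` for all finite families of points and real coefficients. -/
def IsCovarianceFunction {X : Type*} (C : X → X → ℝ) : Prop :=
  (∀ x y, C x y = C y x) ∧
    ∀ (n : ℕ) (x : Fin n → X) (c : Fin n → ℝ), 0 ≤ ∑ i, ∑ j, c i * c j * C (x i) (x j)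

/-- The data `φ₁, φ₂ ∈ Φ_cm` (with domains `D₁, D₂`) and `g` for which the kernel can be written
down. -/
structure IsAdmissible {p : ℕ} (F : Measure ℝ≥0) (D₁ : Set ℝ) (φ₁ : ℝ → ℝ)
    (D₂ : Set ℝ) (φ₂ : ℝ → ℝ) (g : (Fin p → ℝ) → ℝ≥0 → ℝ) : Prop where
  gen₁ : IsCompletelyMonotoneGenerator D₁ φ₁
  /-- `φ₁` is finite at `0 = Q(s, s) τ`, that is, it is the transform of a bounded measure. -/
  zero_mem : (0 : ℝ) ∈ D₁
  gen₂ : IsCompletelyMonotoneGenerator D₂ φ₂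
  /-- `g(·; s)` takes values in the domain of `φ₂⁻¹`; the value `0` is also allowed if
  `φ₂ (+∞) = 0`. -/
  values : ∀ s τ, g s τ ∈ φ₂ '' D₂ ∨ (g s τ = 0 ∧ Tendsto φ₂ atTop (𝓝 0))
  /-- The composition `φ₂ (φ₂⁻¹ (g(τ; s₁)) + φ₂⁻¹ (g(τ; s₂)))` is defined
  (automatic if `D₂` is `(0, ∞)`, `[0, ∞)` or `ℝ`). -/
  composable : ∀ s₁ s₂ τ, g s₁ τ ∈ φ₂ '' D₂ → g s₂ τ ∈ φ₂ '' D₂ →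
    generatorInv D₂ φ₂ (g s₁ τ) + generatorInv D₂ φ₂ (g s₂ τ) ∈ D₂
  meas : ∀ s, AEMeasurable (g s) F

end

/-! Positive semidefiniteness is proved pointwise in `τ` and then integrated against `F`. The
Fourier transform of `exp (-u'Mu)` with `M = Σ(s₁, s₂)` is a multiple of `|M|^{-1/2} exp
(-x'M⁻¹x/4)`, and `exp (-u'Mu)` splits into a factor in `s₁` times a factor in `s₂`. Hence
`detFactor * exp (-l Q)` is an integral over `u` of positive semidefinite kernels
(`sum_detFactor_mul_exp_nonneg`). Mixing over `l = rτ` with the measure of `φ₁` replaces the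
exponential by `φ₁ (Q τ)`. Writing `φ₂` as a Laplace transform too, each `exp (-r (aᵢ + aⱼ))` has
rank one and is absorbed into the coefficients (`sum_mul_quasiArithmetic_nonneg`).

For convergence, `φ₁ ≤ φ₁ 0` on `[0, ∞)`; the composition is dominated by its diagonal values in
case (i), and by the constant `φ₂ 0` in case (ii). Measurability comes from monotonicity of `φ` and
`φ⁻¹`. -/

/-! ### Gaussian kernels with locally varying anisotropy -/

open scoped MatrixOrder in
theorem integrable_gaussian_and_integral {p : ℕ} {M : Matrix (Fin p) (Fin p) ℝ} (hM : M.PosDef)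
    (x : Fin p → ℝ) :
    Integrable (fun u : Fin p → ℝ =>
      Complex.exp (((-(u ⬝ᵥ M *ᵥ u) : ℝ) : ℂ) + ((u ⬝ᵥ x : ℝ) : ℂ) * Complex.I)) ∧
    ∫ u : Fin p → ℝ, Complex.exp (((-(u ⬝ᵥ M *ᵥ u) : ℝ) : ℂ) + ((u ⬝ᵥ x : ℝ) : ℂ) * Complex.I)
      = ((Real.pi ^ ((p : ℝ) / 2) / M.det ^ (1 / 2 : ℝ) *
          Real.exp (-(x ⬝ᵥ M⁻¹ *ᵥ x) / 4) : ℝ) : ℂ) := by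
  obtain ⟨B, hB⟩ := CStarAlgebra.nonneg_iff_eq_star_mul_self.mp hM.posSemidef.nonneg
  rw [Matrix.star_eq_conjTranspose, Matrix.conjTranspose_eq_transpose_of_trivial] at hB
  have hdet : M.det = B.det ^ 2 := by rw [hB, Matrix.det_mul, Matrix.det_transpose, sq]
  have hB0 : B.det ≠ 0 := fun h => hM.det_pos.ne' (by rw [hdet, h]; simp)
  have hBu : IsUnit B.det := isUnit_iff_ne_zero.2 hB0
  -- With `M = BᵀB`, substituting `v = B u` makes the Gaussian isotropic; `w` is chosen so that `u
  -- ⬝ᵥ x = w ⬝ᵥ B u`.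
  set w : Fin p → ℝ := (B⁻¹)ᵀ *ᵥ x with hw
  set f : (Fin p → ℝ) → ℂ := fun v =>
    Complex.exp (-1 * ∑ i, (v i : ℂ) ^ 2 + ∑ i, ((w i : ℂ) * Complex.I) * v i) with hf
  have hfB (u : Fin p → ℝ) : Complex.exp (((-(u ⬝ᵥ M *ᵥ u) : ℝ) : ℂ) +
      ((u ⬝ᵥ x : ℝ) : ℂ) * Complex.I) = f (Matrix.toLin' B u) := by
    have h1 : u ⬝ᵥ M *ᵥ u = ∑ i, (B *ᵥ u) i ^ 2 := by
      rw [hB, ← Matrix.mulVec_mulVec, Matrix.dotProduct_mulVec, Matrix.vecMul_transpose]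
      simp [dotProduct, sq]
    have h2 : u ⬝ᵥ x = ∑ i, w i * (B *ᵥ u) i := by
      change _ = w ⬝ᵥ (B *ᵥ u)
      rw [hw, Matrix.mulVec_transpose, ← Matrix.dotProduct_mulVec, Matrix.mulVec_mulVec,
        Matrix.nonsing_inv_mul _ hBu, Matrix.one_mulVec, dotProduct_comm]
    rw [hf, h1, h2]
    simp only [Matrix.toLin'_apply]
    congr 1
    push_cast
    rw [Finset.sum_mul, neg_one_mul]
    congr 1
    exact Finset.sum_congr rfl fun i _ => by ring
  have hfc : Continuous f := by fun_prop
  have hfi : Integrable f := GaussianFourier.integrable_cexp_neg_mul_sum_add (b := 1) (by simp) _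
  have hmap := Real.map_matrix_volume_pi_eq_smul_volume_pi hB0
  have hlin : Measurable (Matrix.toLin' B) :=
    (LinearMap.continuous_of_finiteDimensional _).measurable
  simp_rw [hfB]
  refine ⟨?_, ?_⟩
  · refine (integrable_map_measure (μ := volume) hfc.aestronglyMeasurable hlin.aemeasurable).1 ?_
    rw [hmap]
    exact hfi.smul_measure ENNReal.ofReal_ne_top
  · rw [← integral_map (μ := volume) hlin.aemeasurable hfc.aestronglyMeasurable, hmap,
      integral_smul_measure, GaussianFourier.integral_cexp_neg_mul_sum_add (by simp)]
    have h3 : ∑ i, (((w i : ℂ)) * Complex.I) ^ 2 = ((-(x ⬝ᵥ M⁻¹ *ᵥ x) : ℝ) : ℂ) := by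
      have : x ⬝ᵥ M⁻¹ *ᵥ x = ∑ i, w i * w i := by
        change _ = w ⬝ᵥ w
        rw [hB, Matrix.mul_inv_rev, ← Matrix.mulVec_mulVec, Matrix.dotProduct_mulVec,
          ← Matrix.transpose_nonsing_inv, hw, Matrix.mulVec_transpose]
      rw [this]
      push_cast
      rw [← Finset.sum_neg_distrib]
      refine Finset.sum_congr rfl fun i _ => ?_
      rw [mul_pow, Complex.I_sq]; ring
    have h4 : M.det ^ (1 / 2 : ℝ) = |B.det| := by
      rw [hdet, ← Real.sqrt_eq_rpow, Real.sqrt_sq_eq_abs]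
    have h5 : ((Real.pi : ℂ) / 1) ^ ((Fintype.card (Fin p) : ℂ) / 2)
        = ((Real.pi ^ ((p : ℝ) / 2) : ℝ) : ℂ) := by
      rw [Complex.ofReal_cpow Real.pi_pos.le]; simp
    rw [h3, h4, h5, ENNReal.toReal_ofReal (abs_nonneg _), abs_inv, mul_one, Complex.real_smul]
    push_cast
    ring

theorem integrable_gaussian_mul_cos {p : ℕ} {M : Matrix (Fin p) (Fin p) ℝ} (hM : M.PosDef)
    (x : Fin p → ℝ) :
    Integrable (fun u : Fin p → ℝ => Real.exp (-(u ⬝ᵥ M *ᵥ u)) * Real.cos (u ⬝ᵥ x)) := by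
  refine (integrable_gaussian_and_integral hM x).1.re.congr (ae_of_all _ fun u => ?_)
  simp [Complex.exp_re]

theorem integral_gaussian_mul_cos {p : ℕ} {M : Matrix (Fin p) (Fin p) ℝ} (hM : M.PosDef)
    (x : Fin p → ℝ) :
    ∫ u : Fin p → ℝ, Real.exp (-(u ⬝ᵥ M *ᵥ u)) * Real.cos (u ⬝ᵥ x)
      = Real.pi ^ ((p : ℝ) / 2) / M.det ^ (1 / 2 : ℝ) * Real.exp (-(x ⬝ᵥ M⁻¹ *ᵥ x) / 4) := by
  obtain ⟨h1, h2⟩ := integrable_gaussian_and_integral hM x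
  have h3 := integral_re h1
  rw [h2] at h3
  rw [← RCLike.ofReal_re (K := ℂ) (_ * Real.exp _)]
  refine Eq.trans (integral_congr_ae (ae_of_all _ fun u => ?_)) h3
  simp [Complex.exp_re]

theorem posDef_avgMatrix {p : ℕ} {S : (Fin p → ℝ) → Matrix (Fin p) (Fin p) ℝ}
    (hS : ∀ s, (S s).PosDef) (s₁ s₂ : Fin p → ℝ) : (avgMatrix S s₁ s₂).PosDef :=
  ((hS s₁).add (hS s₂)).smul (by norm_num)

theorem avgMatrix_comm {p : ℕ} (S : (Fin p → ℝ) → Matrix (Fin p) (Fin p) ℝ) (s₁ s₂ : Fin p → ℝ) :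
    avgMatrix S s₁ s₂ = avgMatrix S s₂ s₁ := by
  simp [avgMatrix, add_comm]

theorem quadForm_comm {p : ℕ} (S : (Fin p → ℝ) → Matrix (Fin p) (Fin p) ℝ) (s₁ s₂ : Fin p → ℝ) :
    quadForm S s₁ s₂ = quadForm S s₂ s₁ := by
  rw [quadForm, quadForm, avgMatrix_comm, ← neg_sub s₂ s₁, Matrix.mulVec_neg, neg_dotProduct_neg]

theorem quadForm_self {p : ℕ} (S : (Fin p → ℝ) → Matrix (Fin p) (Fin p) ℝ) (s : Fin p → ℝ) :
    quadForm S s s = 0 := by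
  simp [quadForm]

theorem quadForm_nonneg {p : ℕ} {S : (Fin p → ℝ) → Matrix (Fin p) (Fin p) ℝ}
    (hS : ∀ s, (S s).PosDef) (s₁ s₂ : Fin p → ℝ) : 0 ≤ quadForm S s₁ s₂ := by
  simpa [quadForm] using
    (posDef_avgMatrix hS s₁ s₂).inv.posSemidef.dotProduct_mulVec_nonneg (s₁ - s₂)

theorem detFactor_comm {p : ℕ} (S : (Fin p → ℝ) → Matrix (Fin p) (Fin p) ℝ) (s₁ s₂ : Fin p → ℝ) :
    detFactor S s₁ s₂ = detFactor S s₂ s₁ := by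
  rw [detFactor, detFactor, avgMatrix_comm, mul_comm (_ ^ _)]

/-- The Gaussian kernel with locally varying anisotropy is positive semidefinite. -/
theorem sum_detFactor_mul_exp_nonneg_of_pos {p : ℕ} {S : (Fin p → ℝ) → Matrix (Fin p) (Fin p) ℝ}
    (hS : ∀ s, (S s).PosDef) {l : ℝ} (hl : 0 < l) {n : ℕ} (x : Fin n → Fin p → ℝ)
    (c : Fin n → ℝ) :
    0 ≤ ∑ i, ∑ j, c i * c j *
      (detFactor S (x i) (x j) * Real.exp (-(l * quadForm S (x i) (x j)))) := by
  -- The frequency is scaled so that `r ^ 2 / 4 = l` in the Gaussian integral.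
  set r : ℝ := 2 * √l with hr
  have hr2 : r ^ 2 = 4 * l := by rw [hr, mul_pow, Real.sq_sqrt hl.le]; norm_num
  set k : ℝ := Real.pi ^ ((p : ℝ) / 2) with hk
  have hk0 : 0 < k := Real.rpow_pos_of_pos Real.pi_pos _
  set a : Fin n → ℝ := fun i => c i * (S (x i)).det ^ (1 / 4 : ℝ) with ha
  set G : Fin n → Fin n → (Fin p → ℝ) → ℝ := fun i j u =>
    Real.exp (-(u ⬝ᵥ avgMatrix S (x i) (x j) *ᵥ u)) * Real.cos (u ⬝ᵥ (r • (x i - x j))) with hG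
  have hterm (i j : Fin n) : c i * c j *
      (detFactor S (x i) (x j) * Real.exp (-(l * quadForm S (x i) (x j))))
      = k⁻¹ * ∫ u, a i * a j * G i j u := by
    rw [integral_const_mul, hG]
    simp only
    rw [integral_gaussian_mul_cos (posDef_avgMatrix hS _ _), Matrix.mulVec_smul,
      smul_dotProduct, dotProduct_smul, smul_eq_mul, smul_eq_mul, ← mul_assoc r r, ← sq, hr2,
      detFactor, quadForm, ha, ← hk]
    have : -(4 * l * ((x i - x j) ⬝ᵥ (avgMatrix S (x i) (x j))⁻¹ *ᵥ (x i - x j))) / 4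
      = -(l * ((x i - x j) ⬝ᵥ (avgMatrix S (x i) (x j))⁻¹ *ᵥ (x i - x j))) := by ring
    rw [this]
    field_simp
  simp_rw [hterm, ← Finset.mul_sum]
  refine mul_nonneg (inv_nonneg.2 hk0.le) ?_
  have hint (i j : Fin n) : Integrable (fun u => a i * a j * G i j u) :=
    (integrable_gaussian_mul_cos (posDef_avgMatrix hS _ _) _).const_mul _
  have : ∑ i, ∑ j, ∫ u, a i * a j * G i j u = ∫ u, ∑ i, ∑ j, a i * a j * G i j u := by
    rw [integral_finsetSum _ fun i _ => integrable_finsetSum _ fun j _ => hint i j]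
    exact Finset.sum_congr rfl fun i _ => (integral_finsetSum _ fun j _ => hint i j).symm
  rw [this]
  refine integral_nonneg fun u => ?_
  set e : Fin n → ℝ := fun i => a i * Real.exp (-(u ⬝ᵥ S (x i) *ᵥ u) / 2) with he
  -- The cosine addition formula gives the squared modulus of `∑ e i * exp (I * r * (u ⬝ᵥ x i))`.
  have hsq : ∑ i, ∑ j, a i * a j * G i j u =
      (∑ i, e i * Real.cos (r * (u ⬝ᵥ x i))) ^ 2 + (∑ i, e i * Real.sin (r * (u ⬝ᵥ x i))) ^ 2 := by
    rw [sq, sq, Finset.sum_mul_sum, Finset.sum_mul_sum, ← Finset.sum_add_distrib]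
    refine Finset.sum_congr rfl fun i _ => ?_
    rw [← Finset.sum_add_distrib]
    refine Finset.sum_congr rfl fun j _ => ?_
    have h1 : -(u ⬝ᵥ avgMatrix S (x i) (x j) *ᵥ u)
        = -(u ⬝ᵥ S (x i) *ᵥ u) / 2 + -(u ⬝ᵥ S (x j) *ᵥ u) / 2 := by
      rw [avgMatrix, Matrix.smul_mulVec, Matrix.add_mulVec, dotProduct_smul, dotProduct_add,
        smul_eq_mul]
      ring
    simp only [hG, he]
    rw [h1, Real.exp_add, dotProduct_smul, dotProduct_sub, smul_eq_mul, mul_sub, Real.cos_sub]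
    ring
  simp only [hsq, Pi.zero_apply]
  positivity

theorem sum_detFactor_mul_exp_nonneg {p : ℕ} {S : (Fin p → ℝ) → Matrix (Fin p) (Fin p) ℝ}
    (hS : ∀ s, (S s).PosDef) {l : ℝ} (hl : 0 ≤ l) {n : ℕ} (x : Fin n → Fin p → ℝ)
    (c : Fin n → ℝ) :
    0 ≤ ∑ i, ∑ j, c i * c j *
      (detFactor S (x i) (x j) * Real.exp (-(l * quadForm S (x i) (x j)))) := by
  have hcont : Continuous fun l : ℝ => ∑ i, ∑ j, c i * c j *
      (detFactor S (x i) (x j) * Real.exp (-(l * quadForm S (x i) (x j)))) := by fun_prop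
  refine ge_of_tendsto (hcont.continuousWithinAt (s := Set.Ioi l)) ?_
  filter_upwards [self_mem_nhdsWithin] with m hm
  exact sum_detFactor_mul_exp_nonneg_of_pos hS (hl.trans_lt hm) x c

/-! ### Completely monotone generators and quasi-arithmetic compositions -/

theorem quasiArithmetic_comm (D : Set ℝ) (φ : ℝ → ℝ) (u v : ℝ) :
    quasiArithmetic D φ u v = quasiArithmetic D φ v u := by
  rw [quasiArithmetic, quasiArithmetic, add_comm]
  classical exact if_congr and_comm rfl rfl

namespace IsCompletelyMonotoneGenerator

variable {D : Set ℝ} {φ : ℝ → ℝ}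

theorem antitoneOn (h : IsCompletelyMonotoneGenerator D φ) : AntitoneOn φ D := by
  obtain ⟨ν, hν⟩ := h.laplace
  intro s hs t ht hst
  rw [(hν s hs).2, (hν t ht).2]
  refine integral_mono (hν t ht).1 (hν s hs).1 fun r => ?_
  simp only
  gcongr

theorem pos (h : IsCompletelyMonotoneGenerator D φ) {t : ℝ} (ht : t ∈ D) : 0 < φ t := by
  obtain ⟨ν, hν⟩ := h.laplace
  -- The zero measure would make `φ` constant on `D`, against injectivity.
  have : NeZero ν := by
    refine ⟨fun h0 => ?_⟩
    have h1 : (1 : ℝ) ∈ D := h.pos_subset (Set.mem_Ioi.2 one_pos)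
    have h2 : (2 : ℝ) ∈ D := h.pos_subset (Set.mem_Ioi.2 two_pos)
    have h12 := h.injOn h1 h2 (by rw [(hν 1 h1).2, (hν 2 h2).2, h0]; simp)
    norm_num at h12
  rw [(hν t ht).2]
  exact integral_exp_pos (hν t ht).1

theorem ne_zero_of_mem_image (h : IsCompletelyMonotoneGenerator D φ) {u : ℝ} (hu : u ∈ φ '' D) :
    u ≠ 0 := by
  obtain ⟨t, ht, rfl⟩ := hu
  exact (h.pos ht).ne'

/-- The `ENNReal`-valued Laplace integral is antitone on all of `ℝ`, even where it diverges;
`toReal` is applied only afterwards, as it could destroy monotonicity. -/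
theorem exists_measurable_eqOn (h : IsCompletelyMonotoneGenerator D φ) :
    ∃ L : ℝ → ℝ, Measurable L ∧ Set.EqOn L φ D := by
  obtain ⟨ν, hν⟩ := h.laplace
  refine ⟨fun t => (∫⁻ r : ℝ≥0, ENNReal.ofReal (Real.exp (-((r : ℝ) * t))) ∂ν).toReal, ?_,
    fun t ht => ?_⟩
  · refine ENNReal.measurable_toReal.comp (Antitone.measurable fun s t hst => ?_)
    refine lintegral_mono fun r => ?_
    simp only
    gcongr
  · rw [(hν t ht).2, integral_eq_lintegral_of_nonneg_ae
      (ae_of_all _ fun r => (Real.exp_pos _).le) (hν t ht).1.1]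

/-- The inverse of a generator extends to an antitone function with values in `EReal`, so it agrees
on its domain with a measurable function, even if the domain is not measurable. -/
theorem exists_measurable_eqOn_generatorInv (h : IsCompletelyMonotoneGenerator D φ) :
    ∃ k : ℝ → ℝ, Measurable k ∧ Set.EqOn k (generatorInv D φ) (φ '' D) := by
  refine ⟨fun u => (sSup ((fun t : ℝ => (t : EReal)) '' {t | t ∈ D ∧ u ≤ φ t})).toReal, ?_, ?_⟩
  · refine Measurable.ereal_toReal (Antitone.measurable fun u v huv => ?_)
    exact sSup_le_sSup (Set.image_mono fun t ht => ⟨ht.1, huv.trans ht.2⟩)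
  · rintro u hu
    have hm : generatorInv D φ u ∈ D := Function.invFunOn_mem hu
    have he : φ (generatorInv D φ u) = u := Function.invFunOn_eq hu
    have hg : IsGreatest ((fun t : ℝ => (t : EReal)) '' {t | t ∈ D ∧ u ≤ φ t})
        (generatorInv D φ u : ℝ) := by
      refine ⟨⟨_, ⟨hm, he.ge⟩, rfl⟩, ?_⟩
      rintro _ ⟨t, ⟨ht, hut⟩, rfl⟩
      rw [EReal.coe_le_coe_iff]
      by_contra! hlt
      have h1 : φ t ≤ φ (generatorInv D φ u) := h.antitoneOn hm ht hlt.le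
      rw [he] at h1
      exact hlt.ne (h.injOn hm ht (he.trans (le_antisymm hut h1)))
    simp only
    rw [hg.isLUB.sSup_eq, EReal.toReal_coe]

theorem quasiArithmetic_nonneg (h : IsCompletelyMonotoneGenerator D φ) {u v : ℝ}
    (huv : u ∈ φ '' D → v ∈ φ '' D → generatorInv D φ u + generatorInv D φ v ∈ D) :
    0 ≤ quasiArithmetic D φ u v := by
  rw [quasiArithmetic]
  split_ifs with hm
  · exact (h.pos (huv hm.1 hm.2)).le
  · exact le_rfl

theorem aemeasurable_quasiArithmetic (h : IsCompletelyMonotoneGenerator D φ) {α : Type*}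
    [MeasurableSpace α] {μ : Measure α} {a b : α → ℝ} (ha : AEMeasurable a μ)
    (hb : AEMeasurable b μ) (hav : ∀ x, a x ∈ φ '' D ∨ a x = 0) (hbv : ∀ x, b x ∈ φ '' D ∨ b x = 0)
    (hab : ∀ x, a x ∈ φ '' D → b x ∈ φ '' D →
      generatorInv D φ (a x) + generatorInv D φ (b x) ∈ D) :
    AEMeasurable (fun x => quasiArithmetic D φ (a x) (b x)) μ := by
  obtain ⟨L, hL, hLφ⟩ := h.exists_measurable_eqOn
  obtain ⟨k, hk, hkφ⟩ := h.exists_measurable_eqOn_generatorInv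
  -- Since `φ > 0` on `D`, membership in `φ '' D` reduces to being nonzero, a measurable condition.
  have hmeas : Measurable fun z : ℝ × ℝ => if z.1 ≠ 0 ∧ z.2 ≠ 0 then L (k z.1 + k z.2) else 0 := by
    refine Measurable.ite ?_ (by fun_prop) measurable_const
    exact (measurable_fst (measurableSet_singleton (0 : ℝ)).compl).inter
      (measurable_snd (measurableSet_singleton (0 : ℝ)).compl)
  refine (hmeas.comp_aemeasurable (ha.prodMk hb)).congr (ae_of_all _ fun x => ?_)
  have h1 : a x ∈ φ '' D ↔ a x ≠ 0 := ⟨h.ne_zero_of_mem_image, (hav x).resolve_right⟩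
  have h2 : b x ∈ φ '' D ↔ b x ≠ 0 := ⟨h.ne_zero_of_mem_image, (hbv x).resolve_right⟩
  simp only [Function.comp_apply, quasiArithmetic, h1, h2]
  split_ifs with hm
  · rw [hkφ (h1.2 hm.1), hkφ (h2.2 hm.2), hLφ (hab x (h1.2 hm.1) (h2.2 hm.2))]
  · rfl

/-- A mixture of nonnegative sums is nonnegative. Terms with `c i j = 0` are exempt from `T i j ∈
D`, which serves indices where `φ⁻¹` is `+∞`. -/
theorem sum_mul_laplace_nonneg (h : IsCompletelyMonotoneGenerator D φ) {ι : Type*} [Fintype ι]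
    {c K : ι → ι → ℝ} {T : ι → ι → ℝ}
    (hT : ∀ i j, c i j ≠ 0 → T i j ∈ D)
    (hK : ∀ r : ℝ≥0, 0 ≤ ∑ i, ∑ j, c i j * (K i j * Real.exp (-((r : ℝ) * T i j)))) :
    0 ≤ ∑ i, ∑ j, c i j * (K i j * φ (T i j)) := by
  obtain ⟨ν, hν⟩ := h.laplace
  have hint (i j : ι) :
      Integrable (fun r : ℝ≥0 => c i j * (K i j * Real.exp (-((r : ℝ) * T i j)))) ν := by
    by_cases h0 : c i j = 0
    · simp [h0]
    · exact ((hν _ (hT i j h0)).1.const_mul _).const_mul _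
  have hterm (i j : ι) : c i j * (K i j * φ (T i j))
      = ∫ r : ℝ≥0, c i j * (K i j * Real.exp (-((r : ℝ) * T i j))) ∂ν := by
    by_cases h0 : c i j = 0
    · simp [h0]
    · rw [integral_const_mul, integral_const_mul, (hν _ (hT i j h0)).2]
  have hsum : ∑ i, ∑ j, c i j * (K i j * φ (T i j))
      = ∫ r : ℝ≥0, ∑ i, ∑ j, c i j * (K i j * Real.exp (-((r : ℝ) * T i j))) ∂ν := by
    rw [integral_finsetSum _ fun i _ => integrable_finsetSum _ fun j _ => hint i j]
    refine Finset.sum_congr rfl fun i _ => ?_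
    rw [integral_finsetSum _ fun j _ => hint i j]
    exact Finset.sum_congr rfl fun j _ => hterm i j
  rw [hsum]
  exact integral_nonneg hK

/-- The entrywise product of a positive semidefinite kernel with a quasi-arithmetic composition is
positive semidefinite. -/
theorem sum_mul_quasiArithmetic_nonneg (h : IsCompletelyMonotoneGenerator D φ) {n : ℕ}
    {K : Fin n → Fin n → ℝ} (hK : ∀ c : Fin n → ℝ, 0 ≤ ∑ i, ∑ j, c i * c j * K i j)
    {u : Fin n → ℝ} (hu : ∀ i j, u i ∈ φ '' D → u j ∈ φ '' D →
      generatorInv D φ (u i) + generatorInv D φ (u j) ∈ D) (c : Fin n → ℝ) :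
    0 ≤ ∑ i, ∑ j, c i * c j * (K i j * quasiArithmetic D φ (u i) (u j)) := by
  classical
  -- Indices with `u i` outside `φ '' D` contribute nothing, so their coefficients are set to zero.
  set d : Fin n → ℝ := fun i => if u i ∈ φ '' D then c i else 0 with hd
  have hmem {i : Fin n} (hi : d i ≠ 0) : u i ∈ φ '' D := by
    by_contra hn
    exact hi (if_neg hn)
  have hterm (i j : Fin n) : c i * c j * (K i j * quasiArithmetic D φ (u i) (u j))
      = d i * d j * (K i j * φ (generatorInv D φ (u i) + generatorInv D φ (u j))) := by
    by_cases hi : u i ∈ φ '' D <;> by_cases hj : u j ∈ φ '' D <;>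
      simp only [quasiArithmetic, hd, hi, hj, and_self, and_true, and_false, if_true, if_false,
        mul_zero, zero_mul]
  simp_rw [hterm]
  refine h.sum_mul_laplace_nonneg (c := fun i j => d i * d j)
    (fun i j hij => hu i j (hmem (left_ne_zero_of_mul hij)) (hmem (right_ne_zero_of_mul hij)))
    fun r => ?_
  refine (hK fun i => d i * Real.exp (-((r : ℝ) * generatorInv D φ (u i)))).trans_eq ?_
  refine Finset.sum_congr rfl fun i _ => Finset.sum_congr rfl fun j _ => ?_
  rw [mul_add, neg_add, Real.exp_add]
  ring

/-- This is positive semidefiniteness of the `2 × 2` matrix tested on `(1, -1)`; it bounds the mixed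
term by the variances. -/
theorem two_mul_quasiArithmetic_le (h : IsCompletelyMonotoneGenerator D φ) {u v : ℝ}
    (huv : ∀ x ∈ ({u, v} : Set ℝ), ∀ y ∈ ({u, v} : Set ℝ), x ∈ φ '' D → y ∈ φ '' D →
      generatorInv D φ x + generatorInv D φ y ∈ D) :
    2 * quasiArithmetic D φ u v ≤ quasiArithmetic D φ u u + quasiArithmetic D φ v v := by
  have hw (i : Fin 2) : ![u, v] i ∈ ({u, v} : Set ℝ) := by fin_cases i <;> simp
  have := h.sum_mul_quasiArithmetic_nonneg (n := 2) (K := fun _ _ => 1) (u := ![u, v])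
    (fun c => by
      simp only [mul_one, ← Finset.sum_mul_sum]
      exact mul_self_nonneg _)
    (fun i j => huv _ (hw i) _ (hw j)) ![1, -1]
  simp [Fin.sum_univ_two, quasiArithmetic_comm D φ v u] at this
  linarith

end IsCompletelyMonotoneGenerator

/-! ### Integrability and positive semidefiniteness of the kernel -/

theorem quasiKernel_comm {p : ℕ} (S : (Fin p → ℝ) → Matrix (Fin p) (Fin p) ℝ) (F : Measure ℝ≥0)
    (φ₁ : ℝ → ℝ) (D₂ : Set ℝ) (φ₂ : ℝ → ℝ) (g : (Fin p → ℝ) → ℝ≥0 → ℝ) (s₁ s₂ : Fin p → ℝ) :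
    quasiKernel S F φ₁ D₂ φ₂ g s₁ s₂ = quasiKernel S F φ₁ D₂ φ₂ g s₂ s₁ := by
  simp only [quasiKernel, quasiIntegrand, detFactor_comm S s₁ s₂, quadForm_comm S s₁ s₂,
    quasiArithmetic_comm D₂ φ₂ (g s₁ _)]

namespace IsAdmissible

variable {p : ℕ} {S : (Fin p → ℝ) → Matrix (Fin p) (Fin p) ℝ} {F : Measure ℝ≥0}
  {D₁ D₂ : Set ℝ} {φ₁ φ₂ : ℝ → ℝ} {g : (Fin p → ℝ) → ℝ≥0 → ℝ}

theorem nonneg_mem (h : IsAdmissible F D₁ φ₁ D₂ φ₂ g) {t : ℝ} (ht : 0 ≤ t) : t ∈ D₁ := by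
  rcases ht.eq_or_lt with rfl | ht
  · exact h.zero_mem
  · exact h.gen₁.pos_subset ht

theorem quadForm_mul_mem (h : IsAdmissible F D₁ φ₁ D₂ φ₂ g) (hS : ∀ s, (S s).PosDef)
    (s₁ s₂ : Fin p → ℝ) (τ : ℝ≥0) : quadForm S s₁ s₂ * τ ∈ D₁ :=
  h.nonneg_mem (mul_nonneg (quadForm_nonneg hS s₁ s₂) τ.2)

theorem quasiArithmetic_nonneg (h : IsAdmissible F D₁ φ₁ D₂ φ₂ g) (s₁ s₂ : Fin p → ℝ) (τ : ℝ≥0) :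
    0 ≤ quasiArithmetic D₂ φ₂ (g s₁ τ) (g s₂ τ) :=
  h.gen₂.quasiArithmetic_nonneg (h.composable s₁ s₂ τ)

theorem aemeasurable_quasiArithmetic (h : IsAdmissible F D₁ φ₁ D₂ φ₂ g) (s₁ s₂ : Fin p → ℝ) :
    AEMeasurable (fun τ => quasiArithmetic D₂ φ₂ (g s₁ τ) (g s₂ τ)) F :=
  h.gen₂.aemeasurable_quasiArithmetic (h.meas s₁) (h.meas s₂)
    (fun τ => (h.values s₁ τ).imp_right And.left) (fun τ => (h.values s₂ τ).imp_right And.left)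
    (h.composable s₁ s₂)

theorem integrable_quasiIntegrand (h : IsAdmissible F D₁ φ₁ D₂ φ₂ g) (hS : ∀ s, (S s).PosDef)
    {s₁ s₂ : Fin p → ℝ}
    (hint : Integrable (fun τ => quasiArithmetic D₂ φ₂ (g s₁ τ) (g s₂ τ)) F) :
    Integrable (quasiIntegrand S φ₁ D₂ φ₂ g s₁ s₂) F := by
  obtain ⟨L, hL, hLφ⟩ := h.gen₁.exists_measurable_eqOn
  refine hint.bdd_mul (c := φ₁ 0) ?_ (ae_of_all _ fun τ => ?_)
  · refine Measurable.aestronglyMeasurable ?_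
    have heq : (fun τ : ℝ≥0 => φ₁ (quadForm S s₁ s₂ * τ))
        = fun τ : ℝ≥0 => L (quadForm S s₁ s₂ * τ) :=
      funext fun τ => (hLφ (h.quadForm_mul_mem hS s₁ s₂ τ)).symm
    rw [heq]
    fun_prop
  · rw [Real.norm_of_nonneg (h.gen₁.pos (h.quadForm_mul_mem hS s₁ s₂ τ)).le]
    exact h.gen₁.antitoneOn h.zero_mem (h.quadForm_mul_mem hS s₁ s₂ τ)
      (mul_nonneg (quadForm_nonneg hS s₁ s₂) τ.2)

theorem integrable_quasiArithmetic_of_self (h : IsAdmissible F D₁ φ₁ D₂ φ₂ g)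
    (hint : ∀ s, Integrable (quasiIntegrand S φ₁ D₂ φ₂ g s s) F) (s₁ s₂ : Fin p → ℝ) :
    Integrable (fun τ => quasiArithmetic D₂ φ₂ (g s₁ τ) (g s₂ τ)) F := by
  have hself (s : Fin p → ℝ) :
      Integrable (fun τ => quasiArithmetic D₂ φ₂ (g s τ) (g s τ)) F := by
    -- On the diagonal `Q = 0`, so the first factor is the positive constant `φ₁ 0`, which divides
    -- out.
    refine ((hint s).const_mul (φ₁ 0)⁻¹).congr (ae_of_all _ fun τ => ?_)
    simp only [quasiIntegrand, quadForm_self, zero_mul]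
    rw [inv_mul_cancel_left₀ (h.gen₁.pos h.zero_mem).ne']
  refine ((hself s₁).add (hself s₂)).mono'
    (h.aemeasurable_quasiArithmetic s₁ s₂).aestronglyMeasurable (ae_of_all _ fun τ => ?_)
  have h0 := h.quasiArithmetic_nonneg s₁ s₂ τ
  rw [Real.norm_of_nonneg h0]
  have h2 := h.gen₂.two_mul_quasiArithmetic_le (u := g s₁ τ) (v := g s₂ τ) (by
    rintro x (rfl | rfl) y (rfl | rfl) <;> exact h.composable _ _ τ)
  simp only [Pi.add_apply]
  linarith

theorem integrable_quasiArithmetic_of_isFiniteMeasure (h : IsAdmissible F D₁ φ₁ D₂ φ₂ g)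
    [IsFiniteMeasure F] (hD₂ : D₂ = Set.Ici 0) (s₁ s₂ : Fin p → ℝ) :
    Integrable (fun τ => quasiArithmetic D₂ φ₂ (g s₁ τ) (g s₂ τ)) F := by
  have h0 : (0 : ℝ) ∈ D₂ := by simp [hD₂]
  refine Integrable.of_bound (h.aemeasurable_quasiArithmetic s₁ s₂).aestronglyMeasurable (φ₂ 0)
    (ae_of_all _ fun τ => ?_)
  rw [Real.norm_of_nonneg (h.quasiArithmetic_nonneg s₁ s₂ τ), quasiArithmetic]
  split_ifs with hm
  · have hmem := h.composable s₁ s₂ τ hm.1 hm.2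
    exact h.gen₂.antitoneOn h0 hmem (hD₂.subset hmem)
  · exact (h.gen₂.pos h0).le

theorem sum_quasiIntegrand_nonneg (h : IsAdmissible F D₁ φ₁ D₂ φ₂ g) (hS : ∀ s, (S s).PosDef)
    {n : ℕ} (x : Fin n → Fin p → ℝ) (c : Fin n → ℝ) (τ : ℝ≥0) :
    0 ≤ ∑ i, ∑ j, c i * c j *
      (detFactor S (x i) (x j) * quasiIntegrand S φ₁ D₂ φ₂ g (x i) (x j) τ) := by
  simp only [quasiIntegrand, ← mul_assoc (detFactor S _ _)]
  refine h.gen₂.sum_mul_quasiArithmetic_nonneg (u := fun i => g (x i) τ)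
    (K := fun i j => detFactor S (x i) (x j) * φ₁ (quadForm S (x i) (x j) * τ))
    (fun d => ?_) (fun i j => h.composable (x i) (x j) τ) c
  refine h.gen₁.sum_mul_laplace_nonneg (c := fun i j => d i * d j)
    (fun i j _ => h.quadForm_mul_mem hS _ _ τ) fun r => ?_
  have := sum_detFactor_mul_exp_nonneg hS (l := (r : ℝ) * τ) (by positivity) x d
  simpa only [mul_assoc, mul_comm (τ : ℝ)] using this

theorem isCovarianceFunction (h : IsAdmissible F D₁ φ₁ D₂ φ₂ g) (hS : ∀ s, (S s).PosDef)
    (hint : ∀ s₁ s₂, Integrable (quasiIntegrand S φ₁ D₂ φ₂ g s₁ s₂) F) :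
    IsCovarianceFunction (quasiKernel S F φ₁ D₂ φ₂ g) := by
  refine ⟨quasiKernel_comm S F φ₁ D₂ φ₂ g, fun n x c => ?_⟩
  have hi (i j : Fin n) : Integrable (fun τ => c i * c j *
      (detFactor S (x i) (x j) * quasiIntegrand S φ₁ D₂ φ₂ g (x i) (x j) τ)) F :=
    ((hint _ _).const_mul _).const_mul _
  have hsum : ∑ i, ∑ j, c i * c j * quasiKernel S F φ₁ D₂ φ₂ g (x i) (x j)
      = ∫ τ, ∑ i, ∑ j, c i * c j *
        (detFactor S (x i) (x j) * quasiIntegrand S φ₁ D₂ φ₂ g (x i) (x j) τ) ∂F := by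
    rw [integral_finsetSum _ fun i _ => integrable_finsetSum _ fun j _ => hi i j]
    refine Finset.sum_congr rfl fun i _ => ?_
    rw [integral_finsetSum _ fun j _ => hi i j]
    refine Finset.sum_congr rfl fun j _ => ?_
    rw [integral_const_mul, integral_const_mul, quasiKernel]
  rw [hsum]
  exact integral_nonneg fun τ => h.sum_quasiIntegrand_nonneg hS x c τ

end IsAdmissible

/-! ### Stein's kernel as the exponential case -/

theorem mem_image_exp_neg_iff {u : ℝ} :
    u ∈ (fun t : ℝ => Real.exp (-t)) '' Set.univ ↔ 0 < u := by
  refine ⟨?_, fun hu => ⟨-Real.log u, trivial, ?_⟩⟩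
  · rintro ⟨t, -, rfl⟩
    exact Real.exp_pos _
  · simp [Real.exp_log hu]

theorem isCompletelyMonotoneGenerator_exp_neg :
    IsCompletelyMonotoneGenerator Set.univ fun t => Real.exp (-t) where
  pos_subset := Set.subset_univ _
  injOn := fun s _ t _ hst => neg_injective (Real.exp_injective hst)
  laplace := ⟨Measure.dirac 1, fun t _ => ⟨integrable_dirac (by simp), by simp⟩⟩

theorem quasiArithmetic_exp_neg {u v : ℝ} (hu : 0 ≤ u) (hv : 0 ≤ v) :
    quasiArithmetic Set.univ (fun t => Real.exp (-t)) u v = u * v := by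
  simp only [quasiArithmetic, mem_image_exp_neg_iff]
  split_ifs with h
  · have hinv {w : ℝ} (hw : 0 < w) :
        Real.exp (-generatorInv Set.univ (fun t => Real.exp (-t)) w) = w :=
      Function.invFunOn_eq (mem_image_exp_neg_iff.2 hw)
    rw [neg_add, Real.exp_add, hinv h.1, hinv h.2]
  -- Outside the image `(0, ∞)` one argument is `0`, and the default value `0` agrees with the
  -- product.
  · rcases hu.eq_or_lt with rfl | hu
    · simp
    · rcases hv.eq_or_lt with rfl | hv
      · simp
      · exact absurd ⟨hu, hv⟩ h

theorem isAdmissible_exp_neg {p : ℕ} {F : Measure ℝ≥0} {g : (Fin p → ℝ) → ℝ≥0 → ℝ}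
    (hg : ∀ s τ, 0 ≤ g s τ) (hm : ∀ s, AEMeasurable (g s) F) :
    IsAdmissible F Set.univ (fun t => Real.exp (-t)) Set.univ (fun t => Real.exp (-t)) g where
  gen₁ := isCompletelyMonotoneGenerator_exp_neg
  zero_mem := trivial
  gen₂ := isCompletelyMonotoneGenerator_exp_neg
  values s τ := (hg s τ).lt_or_eq.imp mem_image_exp_neg_iff.2
    fun h => ⟨h.symm, Real.tendsto_exp_neg_atTop_nhds_zero⟩
  composable _ _ _ _ _ := trivial
  meas := hm

theorem quasiIntegrand_exp_neg {p : ℕ} (S : (Fin p → ℝ) → Matrix (Fin p) (Fin p) ℝ)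
    {g : (Fin p → ℝ) → ℝ≥0 → ℝ} (hg : ∀ s τ, 0 ≤ g s τ) (s₁ s₂ : Fin p → ℝ) (τ : ℝ≥0) :
    quasiIntegrand S (fun t => Real.exp (-t)) Set.univ (fun t => Real.exp (-t)) g s₁ s₂ τ
      = Real.exp (-(quadForm S s₁ s₂ * τ)) * (g s₁ τ * g s₂ τ) := by
  rw [quasiIntegrand, quasiArithmetic_exp_neg (hg s₁ τ) (hg s₂ τ)]

theorem theorem1 (p : ℕ) (S : (Fin p → ℝ) → Matrix (Fin p) (Fin p) ℝ)
    (hS : ∀ s, (S s).PosDef) (F : Measure ℝ≥0) :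
    (∀ (D₁ : Set ℝ) (φ₁ : ℝ → ℝ) (D₂ : Set ℝ) (φ₂ : ℝ → ℝ) (g : (Fin p → ℝ) → ℝ≥0 → ℝ),
      IsAdmissible F D₁ φ₁ D₂ φ₂ g →
      -- the variance integrals are finite, or `F` is finite and `φ₂⁻¹ ∘ g(·; s) ∈ L¹(F)`
      ((∀ s, Integrable (quasiIntegrand S φ₁ D₂ φ₂ g s s) F) ∨
        (IsFiniteMeasure F ∧ D₂ = Set.Ici 0 ∧
          ∀ s, Integrable (fun τ => generatorInv D₂ φ₂ (g s τ)) F)) →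
      (∀ s₁ s₂, Integrable (quasiIntegrand S φ₁ D₂ φ₂ g s₁ s₂) F) ∧
        IsCovarianceFunction (quasiKernel S F φ₁ D₂ φ₂ g)) ∧
    -- Stein's kernel, under Stein's condition `g(·; s) ∈ L²(F)`, is the case `φ₁ = φ₂ = exp (-·)`
    (∀ g : (Fin p → ℝ) → ℝ≥0 → ℝ, (∀ s τ, 0 ≤ g s τ) → (∀ s, MemLp (g s) 2 F) →
      IsAdmissible F Set.univ (fun t => Real.exp (-t)) Set.univ (fun t => Real.exp (-t)) g ∧
      (∀ s, Integrable
        (quasiIntegrand S (fun t => Real.exp (-t)) Set.univ (fun t => Real.exp (-t)) g s s) F) ∧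
      quasiKernel S F (fun t => Real.exp (-t)) Set.univ (fun t => Real.exp (-t)) g
        = steinKernel S F g) := by
  refine ⟨fun D₁ φ₁ D₂ φ₂ g h hyp => ?_, fun g hg hL2 => ?_⟩
  · have hint (s₁ s₂) : Integrable (quasiIntegrand S φ₁ D₂ φ₂ g s₁ s₂) F := by
      refine h.integrable_quasiIntegrand hS ?_
      rcases hyp with hyp | ⟨hF, hD₂, -⟩
      · exact h.integrable_quasiArithmetic_of_self hyp s₁ s₂
      · exact h.integrable_quasiArithmetic_of_isFiniteMeasure hD₂ s₁ s₂
    exact ⟨hint, h.isCovarianceFunction hS hint⟩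
  · refine ⟨isAdmissible_exp_neg hg fun s => (hL2 s).aestronglyMeasurable.aemeasurable,
      fun s => (hL2 s).integrable_sq.congr (ae_of_all _ fun τ => ?_), ?_⟩
    · rw [quasiIntegrand_exp_neg S hg, quadForm_self]
      simp [sq]
    · funext s₁ s₂
      simp only [quasiKernel, steinKernel, quasiIntegrand_exp_neg S hg]
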